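/- Let $\mathbb{H}[q_1,q_2]$ be the ring of slice regular polynomials $P(q_1,q_2)=\sum_{n,m} q_1^n q_2^m a_{n,m}$ (finite sums, $a_{n,m}\in\mathbb{H}$) with the $*$-product $(q_1^nq_2^ma)*(q_1^rq_2^sb)=q_1^{n+r}q_2^{m+s}ab$, and let $\mathbb{H}[q]$ be the analogous ring in one variable. For $P\in\mathbb{H}[q_1,q_2]$ put $P^c=\sum q_1^nq_2^m\overline{a_{n,m}}$ and $P^s=P*P^c$ (the symmetrization of $P$). Let $\mathcal{L}(\mathbb{H})$ be the skew field of quotients of the Ore domain of slice regular functions $\sum_n q^na_n$ on $\mathbb{H}$; it contains $\mathbb{H}[q]$. For a skew field $\mathbb{F}$ let $\mathrm{Det}_k$ denote the Dieudonné determinant on $k\times k$ matrices over $\mathbb{F}$, with values in the abelianization of $\mathbb{F}\setminus\{0\}$ together with the class $[0]$, the value on non-invertible matrices. For $P,Q\in\mathbb{H}[q_1,q_2]$ with $\deg_{q_1}P=n$ and $\deg_{q_1}Q=m$ (the degree of $0$ being $0$), write $P=\sum_{k=0}^n q_1^k P_k(q_2)$ and $Q=\sum_{k=0}^m q_1^kQ_k(q_2)$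 with $P_k,Q_k\in\mathbb{H}[q_2]$. Let $A(q_2)$ be the $(n+m)\times(n+m)$ Sylvester matrix whose $j$-th column, for $0\le j<m$, has entry $P_{i-j}$ in row $i$ ($0\le i<n+m$), and whose $(m+j)$-th column, for $0\le j<n$, has entry $Q_{i-j}$ in row $i$, where $P_k=0$ for $k\notin\{0,\dots,n\}$ and $Q_k=0$ for $k\notin\{0,\dots,m\}$. The regular resultant is $\mathrm{Res}(P,Q;q_1)=\mathrm{Det}_{n+m}(A(q_2))$, computed over $\mathcal{L}(\mathbb{H})$ (the determinant of the empty matrix being $[1]$). The regular resultant $\mathrm{Res}(P,Q;q_2)$ is defined in the same way after writing $P$ and $Q$ as polynomials in $q_2$ with coefficients in $\mathbb{H}[q_1]$. We write $\mathrm{Res}\equiv 0$ if the resultant is the class $[0]$. **Proposition.** Let $P,Q\in\mathbb{H}[q_1,q_2]$. If $\mathrm{Res}(P,Q;q_1)\equiv 0$, then $\mathrm{Res}(P^s,Q^s;q_1)\equiv 0$; and if $\mathrm{Res}(P,Q;q_2)\equiv 0$, then $\mathrm{Res}(P^s,Q^s;q_2)\equiv 0$. -/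

import Mathlib

open scoped Quaternion Polynomial PowerSeries nonZeroDivisors

/-! ### Slice regular polynomials in one and two quaternionic variables

A slice regular polynomial is identified with its family of coefficients. In `R[X]` the variable
commutes with the coefficients, so the product of `ℍ[ℝ][X]` and of `ℍ[ℝ][X][X]` is the
`*`-product of slice regular polynomials. -/

/-- `ℍ[q]`: slice regular polynomials in one variable, with the `*`-product. -/
abbrev SlicePoly : Type := ℍ[ℝ][X]

/-- `ℍ[q₁, q₂]`: slice regular polynomials `∑ q₁ⁿ q₂ᵐ aₙₘ` in two variables, with the `*`-product,
written as polynomials in `q₁` with coefficients in `ℍ[q₂]`; thus `aₙₘ = (P.coeff n).coeff m`. -/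
abbrev SlicePoly₂ : Type := SlicePoly[X]

namespace SlicePoly₂

/-- The same polynomial written as a polynomial in `q₂` with coefficients in `ℍ[q₁]`. -/
noncomputable def swap (P : SlicePoly₂) : SlicePoly[X] :=
  P.sum fun n p => p.sum fun m a => Polynomial.monomial m (Polynomial.monomial n a)

/-- The regular conjugate `Pᶜ = ∑ q₁ⁿ q₂ᵐ conj(aₙₘ)`. -/
noncomputable def regConj (P : SlicePoly₂) : SlicePoly₂ :=
  P.sum fun n p => Polynomial.monomial n (p.sum fun m a => Polynomial.monomial m (star a))

/-- The symmetrization `Pˢ = P * Pᶜ`. -/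
noncomputable def symm (P : SlicePoly₂) : SlicePoly₂ := P * P.regConj

end SlicePoly₂

/-! ### Slice regular functions on `ℍ` and their skew field of quotients -/

namespace EntireSlice

lemma summable_mul {f g : ℍ[ℝ]⟦X⟧} {r : ℝ} (hr : 0 ≤ r)
    (hf : Summable fun n => ‖PowerSeries.coeff n f‖ * r ^ n)
    (hg : Summable fun n => ‖PowerSeries.coeff n g‖ * r ^ n) :
    Summable fun n => ‖PowerSeries.coeff n (f * g)‖ * r ^ n := by
  have h := summable_norm_sum_mul_antidiagonal_of_summable_norm hf.norm hg.norm
  refine Summable.of_nonneg_of_le (fun n => by positivity) (fun n => ?_) h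
  refine le_trans ?_ (le_abs_self _)
  rw [PowerSeries.coeff_mul]
  refine (mul_le_mul_of_nonneg_right (norm_sum_le _ _) (pow_nonneg hr n)).trans ?_
  rw [Finset.sum_mul]
  refine Finset.sum_le_sum fun p hp => ?_
  rw [← Finset.HasAntidiagonal.mem_antidiagonal.1 hp, pow_add, norm_mul]
  exact le_of_eq (by ring)

end EntireSlice

/-- `𝒮ℛ(ℍ)`: the ring of slice regular functions `∑ qⁿ aₙ` on `ℍ` with the `*`-product, that is,
of the power series with quaternionic coefficients that converge on all of `ℍ`. -/
noncomputable def EntireSlice : Subring ℍ[ℝ]⟦X⟧ where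
  carrier := {f | ∀ r : ℝ, 0 ≤ r → Summable fun n => ‖PowerSeries.coeff n f‖ * r ^ n}
  mul_mem' hf hg r hr := EntireSlice.summable_mul hr (hf r hr) (hg r hr)
  one_mem' r _ := by
    refine summable_of_ne_finset_zero (s := {0}) fun n hn => ?_
    simp [PowerSeries.coeff_one, Finset.mem_singleton.not.1 hn]
  add_mem' {f g} hf hg r hr := by
    refine Summable.of_nonneg_of_le (fun n => by positivity) (fun n => ?_)
      ((hf r hr).add (hg r hr))
    rw [map_add, ← add_mul]
    gcongr
    exact norm_add_le _ _
  zero_mem' r _ := by simp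
  neg_mem' {f} hf r hr := by simpa using hf r hr

namespace EntireSlice

/-- The regular conjugate `fᶜ = ∑ qⁿ conj(aₙ)`. -/
noncomputable def conj (f : EntireSlice) : EntireSlice :=
  ⟨PowerSeries.mk fun n => star (PowerSeries.coeff n (f : ℍ[ℝ]⟦X⟧)), fun r hr => by
    simpa using f.2 r hr⟩

lemma conj_ne_zero {f : EntireSlice} (hf : f ≠ 0) : conj f ≠ 0 := by
  intro h
  apply hf
  ext n : 2
  have := congrArg (fun g : EntireSlice => PowerSeries.coeff n (g : ℍ[ℝ]⟦X⟧)) h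
  simpa [conj] using this

/-- `fᶜ * f` has real coefficients, hence is central. -/
lemma conj_mul_self_comm (f g : EntireSlice) :
    conj f * f * g = g * (conj f * f) := by
  have key : ∀ (n : ℕ) (a : ℍ[ℝ]), PowerSeries.coeff n ((conj f * f : EntireSlice) : ℍ[ℝ]⟦X⟧) * a
      = a * PowerSeries.coeff n ((conj f * f : EntireSlice) : ℍ[ℝ]⟦X⟧) := by
    intro n a
    have h : star (PowerSeries.coeff n ((conj f * f : EntireSlice) : ℍ[ℝ]⟦X⟧))
        = PowerSeries.coeff n ((conj f * f : EntireSlice) : ℍ[ℝ]⟦X⟧) := by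
      rw [Subring.coe_mul, PowerSeries.coeff_mul, star_sum, ← Finset.Nat.sum_antidiagonal_swap]
      simp [conj]
    rw [Quaternion.star_eq_self.1 h]
    exact Quaternion.coe_commutes _ _
  ext n : 2
  rw [Subring.coe_mul _ _ g, Subring.coe_mul _ g, PowerSeries.coeff_mul,
    PowerSeries.coeff_mul, ← Finset.Nat.sum_antidiagonal_swap]
  exact Finset.sum_congr rfl fun p _ => key _ _

/-- `𝒮ℛ(ℍ)` is a left Ore domain: `(sᶜ * s) * r = (r * sᶜ) * s`. -/
noncomputable instance : OreLocalization.OreSet (EntireSlice⁰) :=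
  OreLocalization.oreSetOfNoZeroDivisors
    (fun r s => r * conj (s : EntireSlice))
    (fun _ s => ⟨conj (s : EntireSlice) * s, mem_nonZeroDivisors_of_ne_zero
      (mul_ne_zero (conj_ne_zero (nonZeroDivisors.ne_zero s.2)) (nonZeroDivisors.ne_zero s.2))⟩)
    (fun r s => by
      change conj (s : EntireSlice) * s * r = _
      rw [conj_mul_self_comm, mul_assoc])

end EntireSlice

/-- `ℒ(ℍ)`: the skew field of left `*`-quotients of slice regular functions on `ℍ`, the classical
ring of quotients of the Ore domain `𝒮ℛ(ℍ)`. -/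
abbrev SliceQuot : Type := OreLocalization (EntireSlice⁰) EntireSlice

/-- A slice regular polynomial as a slice regular function on `ℍ`. -/
noncomputable def SlicePoly.toEntire : SlicePoly →+* EntireSlice where
  toFun p := ⟨(p : ℍ[ℝ]⟦X⟧), fun r _ => by
    refine summable_of_ne_finset_zero (s := p.support) fun n hn => ?_
    simp [Polynomial.notMem_support_iff.1 hn]⟩
  map_one' := Subtype.ext Polynomial.coe_one
  map_mul' p q := Subtype.ext (Polynomial.coe_mul p q)
  map_zero' := Subtype.ext Polynomial.coe_zero
  map_add' p q := Subtype.ext (Polynomial.coe_add p q)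

/-- The inclusion of `ℍ[q]` in the skew field `ℒ(ℍ)`. -/
noncomputable def SlicePoly.toQuot : SlicePoly →+* SliceQuot :=
  OreLocalization.numeratorRingHom.comp SlicePoly.toEntire

/-! ### The Dieudonné determinant over a skew field -/

/-- The maximal abelian quotient of the multiplicative group of a skew field, with the class of `0`
added. -/
abbrev AbClass (F : Type*) [DivisionRing F] : Type _ := WithZero (Abelianization Fˣ)

open scoped Classical in
/-- The class `[x]` of an element of a skew field. -/
noncomputable def AbClass.mk {F : Type*} [DivisionRing F] (x : F) : AbClass F :=
  if h : x = 0 then 0 else ((Abelianization.of (Units.mk0 x h) : Abelianization Fˣ) :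
    WithZero (Abelianization Fˣ))

open scoped Classical in
/-- The Dieudonné determinant, by elimination along the first column: if `a = A k 0 ≠ 0`, subtract
from each row the left multiple of row `k` that clears its first entry, delete row `k` and column
`0`, and multiply the determinant of the remaining matrix by `[(-1)ᵏ a]`. The sign makes the value
independent of the pivot over every skew field; in a skew field containing `ℍ`, such as `ℒ(ℍ)`,
`-1 = i j i⁻¹ j⁻¹` is a commutator, so there `[(-1)ᵏ a] = [a]`. -/
noncomputable def dieudonneDet {F : Type*} [DivisionRing F] :
    (n : ℕ) → Matrix (Fin n) (Fin n) F → AbClass F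
  | 0, _ => 1
  | n + 1, A =>
    if h : ∃ k, A k 0 ≠ 0 then
      AbClass.mk ((-1) ^ (h.choose : ℕ) * A h.choose 0) *
        dieudonneDet n (Matrix.of fun i j =>
          A (h.choose.succAbove i) j.succ -
            A (h.choose.succAbove i) 0 * (A h.choose 0)⁻¹ * A h.choose j.succ)
    else 0

/-! ### Regular resultants -/

/-- For `S = ∑ xᵏ Sₖ` of degree `n` and `T = ∑ xᵏ Tₖ` of degree `m` with coefficients in `ℍ[q]`, the
`(m + n) × (m + n)` matrix of the linear system `S * H + T * K = 0` in the coefficients of `H`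
(degree `< m`) and `K` (degree `< n`): first `m` columns of shifted coefficients of `S`, then `n`
columns of shifted coefficients of `T`. -/
noncomputable def sliceSylvester (S T : SlicePoly[X]) :
    Matrix (Fin (T.natDegree + S.natDegree)) (Fin (T.natDegree + S.natDegree)) SlicePoly :=
  Polynomial.sylvester T S T.natDegree S.natDegree

namespace SlicePoly₂

/-- The regular resultant `Res(P, Q; q₁)`. -/
noncomputable def res₁ (P Q : SlicePoly₂) : AbClass SliceQuot :=
  dieudonneDet _ ((sliceSylvester P Q).map SlicePoly.toQuot)

/-- The regular resultant `Res(P, Q; q₂)`. -/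
noncomputable def res₂ (P Q : SlicePoly₂) : AbClass SliceQuot :=
  dieudonneDet _ ((sliceSylvester P.swap Q.swap).map SlicePoly.toQuot)

end SlicePoly₂

/-! ### Vanishing of the Dieudonné determinant -/

/-! The resultant vanishes iff there is a nonzero syzygy `p * u + q * v = 0` over `ℒ(ℍ)` with `deg u
< m`, `deg v < n` (`dieudonneDet_eq_zero_iff`, `exists_sylvester_mulVec_eq_zero_iff`). Right
multiples of one syzygy give many in larger degrees, so the combinations `p * h + q * k` with `deg h
< n + 2m`, `deg k < 2n + m` span at most `2(n + m) - 1` dimensions (`finrank_range_bezoutMap_le`).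
They include all `p * s * h + q * t * k` with `deg s ≤ n`, `deg t ≤ m`, `deg h < 2m`, `deg k < 2n`,
a family with `2(n + m)` parameters, so `p * s` and `q * t` have a syzygy too
(`ker_bezoutMap_mul_ne_bot`). Take `s`, `t` to be the conjugates; only their degrees matter.
Exchanging the variables gives the second claim. -/

lemma AbClass.mk_eq_zero_iff {F : Type*} [DivisionRing F] {x : F} : AbClass.mk x = 0 ↔ x = 0 := by
  unfold AbClass.mk
  split_ifs with h <;> simp [h]

/-- The Dieudonné determinant vanishes exactly on the matrices with a nonzero right null vector. -/
theorem dieudonneDet_eq_zero_iff {F : Type*} [DivisionRing F] {n : ℕ}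
    (A : Matrix (Fin n) (Fin n) F) : dieudonneDet n A = 0 ↔ ∃ x ≠ 0, A.mulVec x = 0 := by
  induction n with
  | zero =>
    refine ⟨fun h => absurd h (by simp [dieudonneDet]), ?_⟩
    rintro ⟨x, hx, -⟩
    exact absurd (Subsingleton.elim x 0) hx
  | succ n ih =>
    rw [dieudonneDet]
    split_ifs with h
    · have hk := h.choose_spec
      set k := h.choose
      set a := A k 0
      rw [mul_eq_zero, AbClass.mk_eq_zero_iff, ih]
      have ha : ¬ ((-1) ^ (k : ℕ) * a = 0) := by simp [hk]
      rw [or_iff_right ha]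
      -- A row of the eliminated matrix applied to `y` is row `i` minus a left multiple of the pivot
      -- row.
      have schur : ∀ (i : Fin (n + 1)) (y : Fin n → F),
          ∑ j, (A i j.succ - A i 0 * a⁻¹ * A k j.succ) * y j =
            ∑ j, A i j.succ * y j - A i 0 * (a⁻¹ * ∑ j, A k j.succ * y j) := by
        intro i y
        simp only [sub_mul, Finset.sum_sub_distrib, Finset.mul_sum, mul_assoc]
      constructor
      · rintro ⟨y, hy, hAy⟩
        -- The first coordinate is the one forced by the pivot row.
        refine ⟨Fin.cons (-(a⁻¹ * ∑ j, A k j.succ * y j)) y, ?_, ?_⟩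
        · intro h0
          apply hy
          ext j
          simpa using congrFun h0 j.succ
        · ext i
          rw [Matrix.mulVec, dotProduct, Fin.sum_univ_succ]
          simp only [Fin.cons_zero, Fin.cons_succ, Pi.zero_apply]
          induction i using Fin.succAboveCases k with
          | x => rw [mul_neg, mul_inv_cancel_left₀ hk, neg_add_cancel]
          | p i =>
            have := congrFun hAy i
            rw [Matrix.mulVec, dotProduct] at this
            simp only [Matrix.of_apply, Pi.zero_apply] at this
            rw [schur] at this
            rw [mul_neg, neg_add_eq_sub, this]
      · rintro ⟨x, hx, hAx⟩
        have row : ∀ i, A i 0 * x 0 + ∑ j : Fin n, A i j.succ * x j.succ = 0 := by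
          intro i
          have := congrFun hAx i
          rwa [Matrix.mulVec, dotProduct, Fin.sum_univ_succ] at this
        have x0 : x 0 = -(a⁻¹ * ∑ j : Fin n, A k j.succ * x j.succ) := by
          rw [← mul_neg, ← eq_neg_of_add_eq_zero_left (row k), inv_mul_cancel_left₀ hk]
        refine ⟨fun j => x j.succ, ?_, ?_⟩
        · intro h0
          apply hx
          have hs : ∀ j : Fin n, x j.succ = 0 := fun j => congrFun h0 j
          ext i
          induction i using Fin.cases with
          | zero => simp [x0, hs]
          | succ j => exact hs j
        · ext i
          rw [Matrix.mulVec, dotProduct]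
          simp only [Matrix.of_apply, Pi.zero_apply]
          rw [schur, ← neg_add_eq_sub, ← mul_neg, ← x0, row]
    · push Not at h
      -- The first column is zero, so the first basis vector is killed.
      refine iff_of_true rfl ⟨Pi.single 0 1, by simp, ?_⟩
      ext i
      simp [h i]

/-! ### Polynomials over a skew field as a right vector space -/

namespace Polynomial

variable {F : Type*} [DivisionRing F]

/-- Polynomials of degree less than `N`, as a right vector space over the coefficients. -/
def rightDegreeLT (F : Type*) [DivisionRing F] (N : ℕ) : Submodule Fᵐᵒᵖ F[X] where
  carrier := {p | p.degree < N}
  add_mem' hp hq := (degree_add_le _ _).trans_lt (max_lt hp hq)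
  zero_mem' := by simp
  smul_mem' c _ hp := (degree_smul_le c _).trans_lt hp

lemma mem_rightDegreeLT {N : ℕ} {p : F[X]} : p ∈ rightDegreeLT F N ↔ p.degree < N := Iff.rfl

lemma sum_monomial_mem_rightDegreeLT {N : ℕ} (x : Fin N → F) :
    ∑ i : Fin N, monomial (i : ℕ) (x i) ∈ rightDegreeLT F N :=
  Submodule.sum_mem _ fun i _ =>
    (degree_monomial_le _ _).trans_lt (by exact_mod_cast i.2)

lemma coeff_sum_monomial {N : ℕ} (x : Fin N → F) (j : Fin N) :
    (∑ i : Fin N, monomial (i : ℕ) (x i)).coeff j = x j := by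
  simp [finsetSum_coeff, coeff_monomial, Fin.val_inj]

lemma sum_monomial_coeff {N : ℕ} {p : F[X]} (hp : p ∈ rightDegreeLT F N) :
    ∑ i : Fin N, monomial (i : ℕ) (p.coeff i) = p := by
  rw [Fin.sum_univ_eq_sum_range (fun i => monomial i (p.coeff i)) N]
  ext k
  simp only [finsetSum_coeff, coeff_monomial, Finset.sum_ite_eq', Finset.mem_range]
  split_ifs with h
  · rfl
  · exact (coeff_eq_zero_of_degree_lt (hp.trans_le (by exact_mod_cast not_lt.1 h))).symm

/-- The coefficients of a polynomial of degree less than `N`. -/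
noncomputable def rightDegreeLTEquiv (F : Type*) [DivisionRing F] (N : ℕ) :
    rightDegreeLT F N ≃ₗ[Fᵐᵒᵖ] (Fin N → F) where
  toFun p i := (p : F[X]).coeff i
  map_add' _ _ := by ext; simp
  map_smul' _ _ := by ext; simp
  invFun x := ⟨∑ i : Fin N, monomial (i : ℕ) (x i), sum_monomial_mem_rightDegreeLT x⟩
  left_inv p := Subtype.ext (sum_monomial_coeff p.2)
  right_inv x := _root_.funext fun j => coeff_sum_monomial x j

lemma finrank_op_self : Module.finrank Fᵐᵒᵖ F = 1 :=
  finrank_eq_one 1 one_ne_zero fun w => ⟨MulOpposite.op w, by simp⟩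

instance : Module.Finite Fᵐᵒᵖ F :=
  Module.finite_of_finrank_eq_succ finrank_op_self

instance (N : ℕ) : Module.Finite Fᵐᵒᵖ (rightDegreeLT F N) :=
  Module.Finite.equiv (rightDegreeLTEquiv F N).symm

lemma finrank_rightDegreeLT (N : ℕ) : Module.finrank Fᵐᵒᵖ (rightDegreeLT F N) = N := by
  rw [(rightDegreeLTEquiv F N).finrank_eq, Module.finrank_pi_fintype]
  simp [finrank_op_self]

/-! ### Syzygies and the dimension count -/

lemma mul_mem_rightDegreeLT {n m N : ℕ} {p h : F[X]} (hp : p.natDegree ≤ n)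
    (hh : h ∈ rightDegreeLT F m) (hN : n + m ≤ N) : p * h ∈ rightDegreeLT F N := by
  rw [mem_rightDegreeLT] at *
  by_cases h0 : h = 0
  · simp [h0]
  · have := (natDegree_lt_iff_degree_lt h0).2 hh
    refine degree_le_natDegree.trans_lt (Nat.cast_lt.2 ?_)
    have := natDegree_mul_le (p := p) (q := h)
    omega

/-- Left multiplication by a polynomial commutes with the right scalars. -/
noncomputable def mulLeftOp (p : F[X]) : F[X] →ₗ[Fᵐᵒᵖ] F[X] where
  toFun h := p * h
  map_add' := mul_add p
  map_smul' c h := by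
    have key : ∀ g : F[X], c • g = g * C c.unop := fun g => by ext; simp
    rw [RingHom.id_apply, key, key, mul_assoc]

/-- The map `(h, k) ↦ p * h + q * k` on polynomials of degrees less than `a` and `b`. -/
noncomputable def bezoutMap (p q : F[X]) (a b : ℕ) :
    rightDegreeLT F a × rightDegreeLT F b →ₗ[Fᵐᵒᵖ] F[X] :=
  (mulLeftOp p ∘ₗ (rightDegreeLT F a).subtype).coprod (mulLeftOp q ∘ₗ (rightDegreeLT F b).subtype)

lemma bezoutMap_apply (p q : F[X]) (a b : ℕ) (x : rightDegreeLT F a × rightDegreeLT F b) :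
    bezoutMap p q a b x = p * (x.1 : F[X]) + q * (x.2 : F[X]) := rfl

/-- A syzygy of low degree forces many syzygies among the multiples of larger degree. -/
lemma finrank_range_bezoutMap_le {p q : F[X]} {n m : ℕ} (h : (bezoutMap p q m n).ker ≠ ⊥)
    (N : ℕ) : Module.finrank Fᵐᵒᵖ (bezoutMap p q (N + m) (N + n)).range ≤ N + m + n - 1 := by
  obtain ⟨⟨u, v⟩, huv, hne⟩ := (Submodule.ne_bot_iff _).1 h
  rw [LinearMap.mem_ker, bezoutMap_apply] at huv
  have mem : ∀ {M : ℕ} (w : rightDegreeLT F M) (r : rightDegreeLT F (N + 1)),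
      mulLeftOp (w : F[X]) r ∈ rightDegreeLT F (N + M) := by
    intro M w r
    by_cases w0 : (w : F[X]) = 0
    · simp [mulLeftOp, w0]
    · have := (natDegree_lt_iff_degree_lt w0).2 w.2
      exact mul_mem_rightDegreeLT (Nat.le_sub_one_of_lt this) r.2 (by omega)
  -- The map `r ↦ (u * r, v * r)` embeds an `(N + 1)`-dimensional space in the kernel; it is
  -- injective because `F[X]` is a domain and `(u, v) ≠ 0`.
  let f : rightDegreeLT F (N + 1) →ₗ[Fᵐᵒᵖ] rightDegreeLT F (N + m) × rightDegreeLT F (N + n) :=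
    ((mulLeftOp (u : F[X]) ∘ₗ Submodule.subtype _).codRestrict _ (mem u)).prod
      ((mulLeftOp (v : F[X]) ∘ₗ Submodule.subtype _).codRestrict _ (mem v))
  have hf : ∀ r, f r ∈ (bezoutMap p q (N + m) (N + n)).ker := by
    intro r
    rw [LinearMap.mem_ker, bezoutMap_apply]
    change p * ((u : F[X]) * (r : F[X])) + q * ((v : F[X]) * (r : F[X])) = 0
    rw [← mul_assoc, ← mul_assoc, ← add_mul, huv, zero_mul]
  have inj : Function.Injective (f.codRestrict _ hf) := by
    refine (injective_iff_map_eq_zero _).2 fun r hr => ?_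
    have h12 : f r = 0 := congrArg Subtype.val hr
    have h1 : (u : F[X]) * (r : F[X]) = 0 := congrArg (fun z => (z.1 : F[X])) h12
    have h2 : (v : F[X]) * (r : F[X]) = 0 := congrArg (fun z => (z.2 : F[X])) h12
    by_contra hr0
    have hr0 : (r : F[X]) ≠ 0 := fun h => hr0 (Subtype.ext h)
    apply hne
    ext1
    · exact Subtype.ext ((mul_eq_zero.1 h1).resolve_right hr0)
    · exact Subtype.ext ((mul_eq_zero.1 h2).resolve_right hr0)
  have hker := LinearMap.finrank_le_finrank_of_injective inj
  have hrank := (bezoutMap p q (N + m) (N + n)).finrank_range_add_finrank_ker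
  rw [Module.finrank_prod, finrank_rightDegreeLT, finrank_rightDegreeLT] at hrank
  rw [finrank_rightDegreeLT] at hker
  omega

/-- Multiplying `p` and `q` on the right preserves the existence of a syzygy of low degree. -/
theorem ker_bezoutMap_mul_ne_bot {p q s t : F[X]} {n m : ℕ} (hs : s.natDegree ≤ n)
    (ht : t.natDegree ≤ m) (h : (bezoutMap p q m n).ker ≠ ⊥) :
    (bezoutMap (p * s) (q * t) (2 * m) (2 * n)).ker ≠ ⊥ := by
  -- Associativity moves `s` and `t` into the cofactors, whose degree bounds become `n + 2m` and `m
  -- + 2n`: the case `N = n + m` of the rank bound.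
  have hmem : ∀ x, bezoutMap (p * s) (q * t) (2 * m) (2 * n) x ∈
      (bezoutMap p q (n + m + m) (n + m + n)).range := fun x =>
    ⟨(⟨s * (x.1 : F[X]), mul_mem_rightDegreeLT hs x.1.2 (by omega)⟩,
      ⟨t * (x.2 : F[X]), mul_mem_rightDegreeLT ht x.2.2 (by omega)⟩), by
      simp only [bezoutMap_apply, mul_assoc]⟩
  have hle := finrank_range_bezoutMap_le h (n + m)
  -- Needed for the truncated `2(n + m) - 1` to be strictly below `2(n + m)`.
  have hpos : 0 < n + m := by
    by_contra h0
    obtain ⟨rfl, rfl⟩ : n = 0 ∧ m = 0 := by omega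
    refine h (Submodule.eq_bot_iff _ |>.2 fun x _ => ?_)
    have hz : ∀ w : rightDegreeLT F 0, w = 0 := fun w =>
      (rightDegreeLTEquiv F 0).injective (Subsingleton.elim _ _)
    exact Prod.ext (hz _) (hz _)
  have := LinearMap.ker_ne_bot_of_finrank_lt
    (f := (bezoutMap (p * s) (q * t) (2 * m) (2 * n)).codRestrict _ hmem) (by
      rw [Module.finrank_prod, finrank_rightDegreeLT, finrank_rightDegreeLT]
      omega)
  rwa [LinearMap.ker_codRestrict] at this

/-! ### The Sylvester matrix as a syzygy system -/

lemma coeff_mul_sum_monomial {N d : ℕ} {p : F[X]} (hp : p.natDegree ≤ d) (x : Fin N → F) (i : ℕ) :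
    (p * ∑ j : Fin N, monomial (j : ℕ) (x j)).coeff i =
      ∑ j : Fin N, (if i ∈ Set.Icc (j : ℕ) (j + d) then p.coeff (i - j) else 0) * x j := by
  rw [Finset.mul_sum, finsetSum_coeff]
  refine Finset.sum_congr rfl fun j _ => ?_
  rw [← C_mul_X_pow_eq_monomial, ← mul_assoc, coeff_mul_X_pow', coeff_mul_C]
  simp only [Set.mem_Icc]
  by_cases h1 : (j : ℕ) ≤ i
  · by_cases h2 : i ≤ j + d
    · simp [h1, h2]
    · rw [coeff_eq_zero_of_natDegree_lt (show p.natDegree < i - j by omega)]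
      simp
  · simp [h1]

/-- The argument order `q p` places the columns of `p` first. The unknowns stand on the right, hence
the right vector space structure. -/
lemma sylvester_mulVec {p q : F[X]} {n m : ℕ} (hp : p.natDegree ≤ n) (hq : q.natDegree ≤ m)
    (x : Fin (m + n) → F) (i : Fin (m + n)) :
    (sylvester q p m n).mulVec x i =
      (p * ∑ j : Fin m, monomial (j : ℕ) (x (Fin.castAdd n j)) +
        q * ∑ j : Fin n, monomial (j : ℕ) (x (Fin.natAdd m j))).coeff i := by
  rw [coeff_add, coeff_mul_sum_monomial hp, coeff_mul_sum_monomial hq, Matrix.mulVec, dotProduct,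
    Fin.sum_univ_add]
  simp [sylvester]

/-- Null vectors of the Sylvester matrix are the syzygies of low degree. -/
theorem exists_sylvester_mulVec_eq_zero_iff {p q : F[X]} {n m : ℕ} (hp : p.natDegree ≤ n)
    (hq : q.natDegree ≤ m) :
    (∃ x ≠ 0, (sylvester q p m n).mulVec x = 0) ↔ (bezoutMap p q m n).ker ≠ ⊥ := by
  rw [Submodule.ne_bot_iff]
  constructor
  · rintro ⟨x, hx, h⟩
    refine ⟨(⟨_, sum_monomial_mem_rightDegreeLT fun j => x (Fin.castAdd n j)⟩,
      ⟨_, sum_monomial_mem_rightDegreeLT fun j => x (Fin.natAdd m j)⟩), ?_, ?_⟩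
    · rw [LinearMap.mem_ker, bezoutMap_apply]
      have hmem := (rightDegreeLT F (m + n)).add_mem
        (mul_mem_rightDegreeLT hp
          (sum_monomial_mem_rightDegreeLT fun j => x (Fin.castAdd n j)) (by omega))
        (mul_mem_rightDegreeLT hq
          (sum_monomial_mem_rightDegreeLT fun j => x (Fin.natAdd m j)) (by omega))
      change _ + _ = (0 : F[X])
      rw [← sum_monomial_coeff hmem]
      refine Finset.sum_eq_zero fun i _ => ?_
      rw [← sylvester_mulVec hp hq, h, Pi.zero_apply, map_zero]
    · intro h0
      apply hx
      have h1 := congrArg (fun z => (z.1 : F[X])) h0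
      have h2 := congrArg (fun z => (z.2 : F[X])) h0
      ext i
      induction i using Fin.addCases with
      | left j =>
        rw [← coeff_sum_monomial (fun j => x (Fin.castAdd n j)) j]
        exact congrArg (coeff · j) h1
      | right j =>
        rw [← coeff_sum_monomial (fun j => x (Fin.natAdd m j)) j]
        exact congrArg (coeff · j) h2
  · rintro ⟨⟨u, v⟩, huv, hne⟩
    rw [LinearMap.mem_ker, bezoutMap_apply] at huv
    refine ⟨Fin.append (fun j => (u : F[X]).coeff j) (fun j => (v : F[X]).coeff j), ?_, ?_⟩
    · intro h0
      apply hne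
      ext1
      · refine Subtype.ext ?_
        rw [← sum_monomial_coeff u.2]
        refine Finset.sum_eq_zero fun j _ => ?_
        have := congrFun h0 (Fin.castAdd n j)
        rw [Fin.append_left] at this
        rw [this, Pi.zero_apply, map_zero]
      · refine Subtype.ext ?_
        rw [← sum_monomial_coeff v.2]
        refine Finset.sum_eq_zero fun j _ => ?_
        have := congrFun h0 (Fin.natAdd m j)
        rw [Fin.append_right] at this
        rw [this, Pi.zero_apply, map_zero]
    · ext i
      rw [sylvester_mulVec hp hq]
      simp only [Fin.append_left, Fin.append_right]
      rw [sum_monomial_coeff u.2, sum_monomial_coeff v.2, huv, coeff_zero, Pi.zero_apply]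

end Polynomial

/-! ### Symmetrization and resultants -/

namespace SlicePoly₂

lemma coeff_coeff_regConj (P : SlicePoly₂) (n m : ℕ) :
    (P.regConj.coeff n).coeff m = star ((P.coeff n).coeff m) := by
  rw [regConj, Polynomial.sum_def, Polynomial.finsetSum_coeff]
  simp only [Polynomial.coeff_monomial, Finset.sum_ite_eq', Polynomial.mem_support_iff]
  split_ifs with h
  · rw [Polynomial.sum_def, Polynomial.finsetSum_coeff]
    simp only [Polynomial.coeff_monomial, Finset.sum_ite_eq', Polynomial.mem_support_iff]
    split_ifs with h' <;> simp_all
  · simp_all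

lemma coeff_coeff_swap (P : SlicePoly₂) (n m : ℕ) :
    (P.swap.coeff m).coeff n = (P.coeff n).coeff m := by
  simp only [swap, Polynomial.sum_def, Polynomial.finsetSum_coeff, Polynomial.coeff_monomial]
  have inner : ∀ a b, (if b = m then Polynomial.monomial a ((P.coeff a).coeff b)
      else 0 : SlicePoly).coeff n = if b = m then if a = n then (P.coeff a).coeff b else 0 else 0 := by
    intro a b
    split_ifs <;> simp_all [Polynomial.coeff_monomial]
  simp only [inner, Finset.sum_ite_eq', Polynomial.mem_support_iff]
  rw [Finset.sum_eq_single n]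
  · by_cases h : (P.coeff n).coeff m = 0 <;> simp [h]
  · intro b _ hb
    simp [hb]
  · intro h
    simp [Polynomial.notMem_support_iff.1 h]

lemma coeff_coeff_mul (P Q : SlicePoly₂) (n m : ℕ) :
    ((P * Q).coeff n).coeff m = ∑ a ∈ Finset.HasAntidiagonal.antidiagonal n,
      ∑ b ∈ Finset.HasAntidiagonal.antidiagonal m,
        (P.coeff a.1).coeff b.1 * (Q.coeff a.2).coeff b.2 := by
  simp only [Polynomial.coeff_mul, Polynomial.finsetSum_coeff]

lemma swap_mul (P Q : SlicePoly₂) : swap (P * Q) = P.swap * Q.swap := by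
  ext1 m
  ext1 n
  rw [coeff_coeff_swap, coeff_coeff_mul, coeff_coeff_mul, Finset.sum_comm]
  simp only [coeff_coeff_swap]

lemma swap_symm (P : SlicePoly₂) : swap P.symm = symm P.swap := by
  rw [symm, symm, swap_mul]
  congr 1
  ext1 m
  ext1 n
  rw [coeff_coeff_swap, coeff_coeff_regConj, coeff_coeff_regConj, coeff_coeff_swap]

lemma coeff_regConj_eq_zero_iff (P : SlicePoly₂) (n : ℕ) :
    P.regConj.coeff n = 0 ↔ P.coeff n = 0 := by
  simp [Polynomial.ext_iff, coeff_coeff_regConj]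

lemma natDegree_regConj (P : SlicePoly₂) : P.regConj.natDegree = P.natDegree := by
  have : P.regConj.support = P.support := by
    ext n
    simp [coeff_regConj_eq_zero_iff]
  rw [Polynomial.natDegree, Polynomial.natDegree, Polynomial.degree, Polynomial.degree, this]

/-- Degrees add in a domain and conjugation keeps them. This matches the size of the symmetrized
Sylvester matrix with the bounds `2m`, `2n` of the dimension count. -/
lemma natDegree_symm (P : SlicePoly₂) : P.symm.natDegree = 2 * P.natDegree := by
  rw [symm]
  by_cases h : P = 0
  · simp [h]
  · have h' : P.regConj ≠ 0 := by
      intro h0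
      refine h (Polynomial.ext fun n => ?_)
      rw [Polynomial.coeff_zero, ← coeff_regConj_eq_zero_iff, h0, Polynomial.coeff_zero]
    rw [Polynomial.natDegree_mul h h', natDegree_regConj, two_mul]

/-- The resultant vanishes if and only if there is a syzygy of low degree over `ℒ(ℍ)`. -/
lemma res₁_eq_zero_iff (P Q : SlicePoly₂) :
    P.res₁ Q = 0 ↔ (Polynomial.bezoutMap (P.map SlicePoly.toQuot) (Q.map SlicePoly.toQuot)
      Q.natDegree P.natDegree).ker ≠ ⊥ := by
  rw [res₁, dieudonneDet_eq_zero_iff, ← Polynomial.exists_sylvester_mulVec_eq_zero_iff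
    Polynomial.natDegree_map_le Polynomial.natDegree_map_le, Polynomial.sylvester_map_map]
  rfl

theorem res₁_symm_eq_zero {P Q : SlicePoly₂} (h : P.res₁ Q = 0) : P.symm.res₁ Q.symm = 0 := by
  rw [res₁_eq_zero_iff] at h ⊢
  rw [natDegree_symm, natDegree_symm, symm, symm, Polynomial.map_mul, Polynomial.map_mul]
  exact Polynomial.ker_bezoutMap_mul_ne_bot
    (Polynomial.natDegree_map_le.trans (natDegree_regConj P).le)
    (Polynomial.natDegree_map_le.trans (natDegree_regConj Q).le) h

end SlicePoly₂

theorem mainTheorem4 (P Q : SlicePoly₂) :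
    (P.res₁ Q = 0 → P.symm.res₁ Q.symm = 0) ∧
    (P.res₂ Q = 0 → P.symm.res₂ Q.symm = 0) := by
  refine ⟨SlicePoly₂.res₁_symm_eq_zero, fun h => ?_⟩
  -- By definition `res₂` is `res₁` of the swapped polynomials, and swapping commutes with
  -- symmetrization.
  change SlicePoly₂.res₁ P.symm.swap Q.symm.swap = 0
  rw [SlicePoly₂.swap_symm, SlicePoly₂.swap_symm]
  exact SlicePoly₂.res₁_symm_eq_zero h
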